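/- Let $N=10$, and for $k\ge 1$ let $G_k$ be the $N^k\times N^k$ grid network: nodes $(i,j)$ with $0\le i,j<N^k$, two nodes being neighbors iff they agree in one coordinate and differ by $1$ in the other. For a node $p=(i,j)$ of $G_k$, the macro-node $G(p)$ is the $N\times N$ subgrid of $G_{k+1}$ whose node $(0,0)$ is $(Ni,Nj)$. **Executions.** A broadcast protocol is *accumulative* if the memory of each node only grows and each node has rules of the form "once the finite set $X$ of elements belongs to the memory, eventually do $a$", where $a$ is: add an element to a dynamic set, send a message to a node, or accept a pair $(s,m)$ (read: "$s$ broadcast $m$"). Executions are asynchronous; any node may broadcast any messages at any times; correct nodes follow their rules; every message sent between correct neighbors is eventually received; a node knows which neighbor it received a message from; the non-correct (Byzantine) nodes can send anything to their neighbors at any time. For a protocol and a set $\mathrm{Corr}$ of correct nodes, a set $R\subseteq \mathrm{Corr}$ is *reliable* if for all $s,r\in R$ (possibly equal) and every message $m$, in every execution: (1) if $s$ broadcasts $m$, then $r$ eventually accepts $(s,m)$; (2) if $r$ accepts $(s,m)$, then $s$ has broadcast $m$. **The protocol.** Let $\mathrm{CZP}$ be any accumulative broadcast protocol on the $N\times N$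 grid, available for every set of message contents; in particular it may be the Control Zone Protocol, with any set of control zones. The protocol $\mathrm{BP}_k$ on $G_k$ is defined by $\mathrm{BP}_1=\mathrm{CZP}$ and as follows. In $\mathrm{BP}_{k+1}$, CZP is executed inside each macro-node $G(p)$, and each node of $G(p)$ moreover simulates the node $p$ of $G_k$ executing $\mathrm{BP}_k$. For neighbors $p,q$ of $G_k$, when the simulation of $p$ at a node of $G(p)$ sends $x$ to $q$, this node, if it has a neighbor in $G(q)$, sends $x$ to that neighbor, which then broadcasts ($x$, from $p$) in $G(q)$ with CZP; a node of $G(q)$ that has accepted ($x$, from $p$) through CZP from strictly more than $N/2$ distinct nodes of $G(q)$ having a neighbor in $G(p)$ considers, in its simulation of $q$, that $x$ was received from $p$. When $s\in G(p)$ wants to broadcast $m$ in $G_{k+1}$, it broadcasts $m$ in $G(p)$ with CZP; the nodes of $G(p)$ that accept $(s,m)$ broadcast $(s,m)$ as $p$ in the simulation; a node accepts $(s,m)$ when its simulation accepts that $p$ broadcast $(s,m)$, where $p$ is the node of $G_k$ with $s\in G(p)$. **The node sets.** Let $\mathrm{Rel}_{CZP}$ be any function such that, for every set $C$ of correct nodes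 of the $N\times N$ grid, $\mathrm{Rel}_{CZP}(C)$ is a reliable node set for $\mathrm{CZP}$ (for every set of message contents). An $N\times N$ grid with set $C$ of correct nodes is called *correct* if each of its four sides has strictly more than $3N/4$ nodes in $\mathrm{Rel}_{CZP}(C)$. Put $\mathrm{Rel}_1=\mathrm{Rel}_{CZP}$ and $$\mathrm{Rel}_{k+1}(\mathrm{Corr})=\bigcup_{p\in \mathrm{Rel}_k(\mathrm{Corr}')}\mathrm{Rel}_{CZP}(\mathrm{Corr}(p)),$$ where $\mathrm{Corr}(p)$ is the restriction of $\mathrm{Corr}$ to $G(p)$ and $\mathrm{Corr}'$ is the set of nodes $p$ of $G_k$ such that $G(p)$, with the set $\mathrm{Corr}(p)$, is correct. **Theorem.** For every $k\ge 1$ and every set $\mathrm{Corr}$ of correct nodes of $G_k$, the set $\mathrm{Rel}_k(\mathrm{Corr})$ is a reliable node set for $\mathrm{BP}_k$. -/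

import Mathlib

/-! ### Grid networks -/

/-- The side length of a cluster. -/
abbrev N : ℕ := 10

/-- Nodes of the network `G_k`, identified by their position on the `N^k × N^k` grid. -/
abbrev Node (k : ℕ) : Type := Fin (N ^ k) × Fin (N ^ k)

/-- The `M × M` grid network. -/
def gridGraph (M : ℕ) : SimpleGraph (Fin M × Fin M) where
  Adj a b :=
    (a.1 = b.1 ∧ |((a.2 : ℕ) : ℤ) - ((b.2 : ℕ) : ℤ)| = 1) ∨
    (a.2 = b.2 ∧ |((a.1 : ℕ) : ℤ) - ((b.1 : ℕ) : ℤ)| = 1)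
  symm := ⟨by
    rintro a b (⟨h, h'⟩ | ⟨h, h'⟩)
    · exact Or.inl ⟨h.symm, by rwa [abs_sub_comm]⟩
    · exact Or.inr ⟨h.symm, by rwa [abs_sub_comm]⟩⟩
  loopless := ⟨by rintro a (⟨_, h⟩ | ⟨_, h⟩) <;> simp at h⟩

/-- The network `G_k`. -/
abbrev gridNet (k : ℕ) : SimpleGraph (Node k) := gridGraph (N ^ k)

theorem div_lt_side {k : ℕ} (i : Fin (N ^ (k + 1))) : (i : ℕ) / N < N ^ k :=
  Nat.div_lt_of_lt_mul (i.isLt.trans_eq (pow_succ' N k))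

theorem mod_lt_side {k : ℕ} (i : Fin (N ^ (k + 1))) : (i : ℕ) % N < N ^ 1 := by
  rw [pow_one]; exact Nat.mod_lt _ (by norm_num)

/-- The node `p` of `G_k` whose macro-node `G(p)` contains the node `v` of `G_{k+1}`: the
macro-node of `(i, j)` consists of the nodes `(N i + a, N j + b)` with `0 ≤ a, b < N`. -/
def macroOf {k : ℕ} (v : Node (k + 1)) : Node k :=
  (⟨(v.1 : ℕ) / N, div_lt_side v.1⟩, ⟨(v.2 : ℕ) / N, div_lt_side v.2⟩)

/-- The position of the node `v` of `G_{k+1}` inside its macro-node, an `N × N` grid. -/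
def posIn {k : ℕ} (v : Node (k + 1)) : Node 1 :=
  (⟨(v.1 : ℕ) % N, mod_lt_side v.1⟩, ⟨(v.2 : ℕ) % N, mod_lt_side v.2⟩)

/-- The nodes of `G(q)` that have a neighbor in `G(p)`. -/
def macroBorder {k : ℕ} (q p : Node k) : Set (Node (k + 1)) :=
  {w | macroOf w = q ∧ ∃ w', (gridNet (k + 1)).Adj w w' ∧ macroOf w' = p}

/-! ### Accumulative protocols and their executions -/

/-- What a node can do: add an element to one of its dynamic sets (`Item` is the disjoint union
of the possible elements of these sets), send `x` to `u`, or accept `(s, m)`, that is, the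
message `m` as having been broadcast by `s`. -/
inductive NodeAction (V M Msg Item : Type) : Type where
  | add (i : Item)
  | send (u : V) (x : Msg)
  | accept (s : V) (m : M)

/-- What can have happened at a node: it was asked to broadcast `m` (this is the event
"the node broadcasts `m`"), it received `x` from `u`, or it did the action `a`. -/
inductive NodeFact (V M Msg Item : Type) : Type where
  | input (m : M)
  | recv (u : V) (x : Msg)
  | did (a : NodeAction V M Msg Item)

/-- An accumulative broadcast protocol, for the nodes `V` and messages in `M`. The memory of a
node only grows, and `rule v X a` says that the node `v` eventually does `a` once all the (finitely
many) members of `X` belong to its memory. -/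
structure Protocol (V M : Type) : Type 1 where
  Msg : Type
  Item : Type
  rule : V → List (NodeFact V M Msg Item) → NodeAction V M Msg Item → Prop

/-- The possible contents of the memory of a node. -/
abbrev Protocol.F {V M : Type} (P : Protocol V M) : Type := NodeFact V M P.Msg P.Item

/-- `σ n v` is the memory of the node `v` at time `n` in an asynchronous execution of `P` on the
network `G` in which the nodes of `Corr` are correct and the others are Byzantine. Any node may be
asked to broadcast any message at any time, a message received from a correct neighbor was sent by
it, and a Byzantine node can send anything to its neighbors at any time. -/
structure IsRun {V M : Type} (G : SimpleGraph V) (P : Protocol V M) (Corr : Set V)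
    (σ : ℕ → V → Set P.F) : Prop where
  init : ∀ v ∈ Corr, σ 0 v = ∅
  mono : ∀ v ∈ Corr, ∀ n, σ n v ⊆ σ (n + 1) v
  recv : ∀ v ∈ Corr, ∀ n u x, NodeFact.recv u x ∈ σ (n + 1) v → NodeFact.recv u x ∉ σ n v →
    G.Adj u v ∧ (u ∈ Corr → NodeFact.did (NodeAction.send v x) ∈ σ n u)
  act : ∀ v ∈ Corr, ∀ n a, NodeFact.did a ∈ σ (n + 1) v → NodeFact.did a ∉ σ n v →
    ∃ X, P.rule v X a ∧ ∀ f ∈ X, f ∈ σ n v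

/-- Nothing is delayed forever: each message sent from a correct node to a correct neighbor is
eventually received, and a correct node eventually does what its rules ask for. -/
structure IsFair {V M : Type} (G : SimpleGraph V) (P : Protocol V M) (Corr : Set V)
    (σ : ℕ → V → Set P.F) : Prop where
  deliver : ∀ u ∈ Corr, ∀ v ∈ Corr, G.Adj u v → ∀ n x, NodeFact.did (NodeAction.send v x) ∈ σ n u →
    ∃ n', NodeFact.recv u x ∈ σ n' v
  fire : ∀ v ∈ Corr, ∀ X a, P.rule v X a → ∀ n, (∀ f ∈ X, f ∈ σ n v) →
    ∃ n', NodeFact.did a ∈ σ n' v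

/-- `R` is a reliable node set for `P` when the correct nodes are those of `Corr`. -/
def IsReliable {V M : Type} (G : SimpleGraph V) (P : Protocol V M) (Corr R : Set V) : Prop :=
  R ⊆ Corr ∧ ∀ s ∈ R, ∀ r ∈ R, ∀ m : M,
    (∀ σ, IsRun G P Corr σ → IsFair G P Corr σ →
      ∀ n, NodeFact.input m ∈ σ n s → ∃ n', NodeFact.did (NodeAction.accept s m) ∈ σ n' r) ∧
    (∀ σ, IsRun G P Corr σ →
      ∀ n, NodeFact.did (NodeAction.accept s m) ∈ σ n r → NodeFact.input m ∈ σ n s)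

/-! ### The Control Zone Protocol -/

/-- A control zone: a core, isolated from the rest of the network by a border. -/
structure ControlZone {V : Type} (G : SimpleGraph V) : Type where
  core : Set V
  border : Set V
  disj : Disjoint core border
  isolates : ∀ u ∈ core, ∀ v, G.Adj u v → v ∈ core ∪ border

/-- Standard messages and authorization messages. -/
inductive CZPMsg {V : Type} (G : SimpleGraph V) (M : Type) : Type where
  | std (s : V) (m : M)
  | auth (s : V) (m : M) (z : ControlZone G)

/-- The elements of the dynamic sets `Wait` and `Auth` of a node. -/
inductive CZPItem {V : Type} (G : SimpleGraph V) (M : Type) : Type where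
  | wait (s : V) (m : M) (q : V)
  | auth (s : V) (m : M) (z : ControlZone G)

open NodeFact NodeAction in
/-- The rules of the Control Zone Protocol: accepted messages are relayed to all neighbors, but a
node of the border of a control zone accepts from a node of its core a message whose source lies
outside the core only when an authorization, which is issued on the border when this message
arrives from outside the core and which circulates along the border, has reached it. -/
inductive CZPRule {V : Type} {G : SimpleGraph V} {M : Type} (Z : Set (ControlZone G)) (p : V) :
    List (NodeFact V M (CZPMsg G M) (CZPItem G M)) → NodeAction V M (CZPMsg G M) (CZPItem G M) → Prop
  | start (m : M) : CZPRule Z p [input m] (accept p m)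
  | relay (s : V) (m : M) (q : V) (hq : G.Adj p q) :
      CZPRule Z p [did (accept s m)] (send q (.std s m))
  | receive (s : V) (m : M) (q : V) : CZPRule Z p [recv q (.std s m)] (add (.wait s m q))
  | accept (s : V) (m : M) (q : V) (L : List (ControlZone G))
      (hL : ∀ z ∈ Z, p ∈ z.border → q ∈ z.core → s ∉ z.core → z ∈ L) :
      CZPRule Z p (did (add (.wait s m q)) :: L.map fun z => did (add (.auth s m z)))
        (accept s m)
  | authorizeOwn (m : M) (z : ControlZone G) (hz : z ∈ Z) (hp : p ∈ z.border) :
      CZPRule Z p [input m] (add (.auth p m z))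
  | authorize (s : V) (m : M) (q : V) (z : ControlZone G) (hz : z ∈ Z) (hp : p ∈ z.border)
      (hq : q ∉ z.core) :
      CZPRule Z p [did (add (.wait s m q)), did (accept s m)] (add (.auth s m z))
  | relayAuth (s : V) (m : M) (q : V) (z : ControlZone G) (hz : z ∈ Z) (hp : p ∈ z.border)
      (hq : q ∈ z.border) (hpq : G.Adj p q) :
      CZPRule Z p [did (add (.auth s m z))] (send q (.auth s m z))
  | receiveAuth (s : V) (m : M) (q : V) (z : ControlZone G) (hz : z ∈ Z) (hp : p ∈ z.border)
      (hq : q ∈ z.border) :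
      CZPRule Z p [recv q (.auth s m z)] (add (.auth s m z))

/-- The Control Zone Protocol on the network `G` with the set `Z` of control zones. -/
def czp {V : Type} {G : SimpleGraph V} (Z : Set (ControlZone G)) (M : Type) : Protocol V M where
  Msg := CZPMsg G M
  Item := CZPItem G M
  rule p := CZPRule Z p

/-! ### The hierarchical broadcast protocol -/

section Hierarchy

variable {k : ℕ} {M : Type}

/-- The contents that are broadcast inside a macro-node `G(q)` of `G_{k+1}`, where `X` is the set
of messages exchanged in `G_k`: `inl m` is a message that a node of `G(q)` wants to broadcast in
`G_{k+1}`, and `inr (p, x)` is a message `x` coming through the macro-channel from `G(p)`. -/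
abbrev LocalContent (k : ℕ) (M X : Type) : Type := M ⊕ (Node k × X)

/-- The messages of the protocol on `G_{k+1}`: those of the local protocol `L` inside
macro-nodes, and those sent from the border of a macro-node to the border of another one. -/
abbrev HierMsg (P : Protocol (Node k) (Node (k + 1) × M))
    (L : Protocol (Node 1) (LocalContent k M P.Msg)) : Type := L.Msg ⊕ P.Msg

/-- The memory elements of a node of `G(q)`: its memory in the local protocol `L` inside `G(q)`
and its memory in the simulation of the node `q` executing the protocol `P` on `G_k`. -/
abbrev HierItem (P : Protocol (Node k) (Node (k + 1) × M))
    (L : Protocol (Node 1) (LocalContent k M P.Msg)) : Type := L.F ⊕ P.F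

/-- `f` holds in the local protocol. -/
abbrev loc {P : Protocol (Node k) (Node (k + 1) × M)}
    {L : Protocol (Node 1) (LocalContent k M P.Msg)} (f : L.F) :
    NodeFact (Node (k + 1)) M (HierMsg P L) (HierItem P L) :=
  NodeFact.did (NodeAction.add (Sum.inl f))

/-- `f` holds in the simulation. In particular the dynamic set `Sen_q` consists of the `x` with
`sim (did (send q x))` and the dynamic set `Rec_p` consists of the `x` with `sim (recv p x)`. -/
abbrev sim {P : Protocol (Node k) (Node (k + 1) × M)}
    {L : Protocol (Node 1) (LocalContent k M P.Msg)} (f : P.F) :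
    NodeFact (Node (k + 1)) M (HierMsg P L) (HierItem P L) :=
  NodeFact.did (NodeAction.add (Sum.inr f))

open NodeFact NodeAction in
/-- The rules executed by a node `v` of `G_{k+1}`, which belongs to `G(macroOf v)`. -/
inductive HierRule (P : Protocol (Node k) (Node (k + 1) × M))
    (L : Protocol (Node 1) (LocalContent k M P.Msg)) (v : Node (k + 1)) :
    List (NodeFact (Node (k + 1)) M (HierMsg P L) (HierItem P L)) →
    NodeAction (Node (k + 1)) M (HierMsg P L) (HierItem P L) → Prop
  /- The local protocol inside the macro-node. -/
  | locStep (X : List L.F) (a) (h : L.rule (posIn v) X a) :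
      HierRule P L v (X.map loc) (add (.inl (did a)))
  | locSend (w : Node (k + 1)) (x) (hw : macroOf w = macroOf v) :
      HierRule P L v [loc (did (send (posIn w) x))] (send w (.inl x))
  | locRecv (w : Node (k + 1)) (x) (hw : macroOf w = macroOf v) :
      HierRule P L v [recv w (.inl x)] (add (.inl (recv (posIn w) x)))
  /- The simulation of the corresponding node of `G_k`. -/
  | simStep (X : List P.F) (a) (h : P.rule (macroOf v) X a) :
      HierRule P L v (X.map sim) (add (.inr (did a)))
  /- The macro-channels: nodes of the border send to their neighbor in the other border; it
  broadcasts what it receives in its macro-node; strictly more than `N / 2` votes are needed. -/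
  | chanSend (w : Node (k + 1)) (x) (hw : (gridNet (k + 1)).Adj v w)
      (hadj : (gridNet k).Adj (macroOf v) (macroOf w)) :
      HierRule P L v [sim (did (send (macroOf w) x))] (send w (.inr x))
  | chanRecv (w : Node (k + 1)) (x) (hadj : (gridNet k).Adj (macroOf w) (macroOf v)) :
      HierRule P L v [recv w (.inr x)] (add (.inl (input (.inr (macroOf w, x)))))
  | chanVote (p : Node k) (x) (hadj : (gridNet k).Adj p (macroOf v))
      (W : List (Node (k + 1))) (hnodup : W.Nodup) (hborder : ∀ w ∈ W, w ∈ macroBorder (macroOf v) p)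
      (hmaj : N < 2 * W.length) :
      HierRule P L v (W.map fun w => loc (did (accept (posIn w) (.inr (p, x)))))
        (add (.inr (recv p x)))
  /- A message to broadcast in `G_{k+1}` is first broadcast in the macro-node; the nodes of the
  macro-node that accept it broadcast it, with its source, in the simulation of `G_k`; a message
  is accepted when the simulation attributes it to the macro-node that contains its source. -/
  | start (m : M) : HierRule P L v [input m] (add (.inl (input (.inl m))))
  | simInput (s : Node (k + 1)) (m : M) (hs : macroOf s = macroOf v) :
      HierRule P L v [loc (did (accept (posIn s) (.inl m)))] (add (.inr (input (s, m))))
  | finish (s : Node (k + 1)) (m : M) :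
      HierRule P L v [sim (did (accept (macroOf s) (s, m)))] (accept s m)

end Hierarchy

/-- The broadcast protocol of `G_{k+1}` for messages in `M`, built from the protocol `base` on the
`N × N` grid. -/
def hierBP (base : (C : Type) → Protocol (Node 1) C) :
    (k : ℕ) → (M : Type) → Protocol (Node (k + 1)) M
  | 0, M => base M
  | k + 1, M =>
    let P := hierBP base k (Node (k + 2) × M)
    let L := base (LocalContent (k + 1) M P.Msg)
    { Msg := HierMsg P L
      Item := HierItem P L
      rule := HierRule P L }

/-! ### The reliable node sets -/

/-- The distribution of correct nodes on the `N × N` grid `G(p)`. -/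
def corrIn {k : ℕ} (Corr : Set (Node (k + 1))) (p : Node k) : Set (Node 1) :=
  {a | ∃ v ∈ Corr, macroOf v = p ∧ posIn v = a}

/-- An `N × N` grid with distribution `C` of correct nodes is correct if each of its four sides has
strictly more than `3 N / 4` nodes in `Rel₁ C`. -/
def IsCorrectMacroNode (Rel₁ : Set (Node 1) → Set (Node 1)) (C : Set (Node 1)) : Prop :=
  3 * N < 4 * {a ∈ Rel₁ C | (a.1 : ℕ) = 0}.ncard ∧
  3 * N < 4 * {a ∈ Rel₁ C | (a.1 : ℕ) = N - 1}.ncard ∧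
  3 * N < 4 * {a ∈ Rel₁ C | (a.2 : ℕ) = 0}.ncard ∧
  3 * N < 4 * {a ∈ Rel₁ C | (a.2 : ℕ) = N - 1}.ncard

/-- The node set `Rel_{k+1}(Corr)` of `G_{k+1}`, where `Rel₁` is `Rel_CZP`. -/
def relSet (Rel₁ : Set (Node 1) → Set (Node 1)) :
    (k : ℕ) → Set (Node (k + 1)) → Set (Node (k + 1))
  | 0, Corr => Rel₁ Corr
  | k + 1, Corr =>
    {v | macroOf v ∈ relSet Rel₁ k {p | IsCorrectMacroNode Rel₁ (corrIn Corr p)} ∧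
      posIn v ∈ Rel₁ (corrIn Corr (macroOf v))}

/-! ### Geometry of macro-nodes -/

section Geometry

variable {k : ℕ}

/-! The proof is by induction on the level. One step (`isReliable_hierProtocol`) combines a reliable
protocol `P` on `G_k` with a reliable local protocol `L`. The geometric input is a count. Facing
sides of two correct macro-nodes both have more than `3N/4` reliable nodes, so more than `N/2` of
the `N` links are reliable at both ends. These links alone form a voting majority, and they meet
every other majority.

Safety: call a fact true of `p` when some reliable node of `G(p)` holds it in its simulation. This
union of simulations is a genuine run of `P` on `G_k` (`isRun_simUnion`). A winning vote contains a
reliable link, along which the message is traced back to the sender's simulation. Safety of `P` and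
then of `L` leads from an acceptance to the original broadcast.

Liveness: the union need not be fair, since the premises of a rule may hold at different nodes of
`G(p)`. Instead, consider the facts that eventually hold at all reliable nodes of `G(p)`. They are
closed under the rules of `P` and under delivery between correct macro-nodes. Because protocols are
accumulative, they contain everything in the synchronous run with silent Byzantine nodes
(`syncRun_subset`). That run is fair, so liveness of `P` applies to it. -/

theorem pos_lt (i : Fin (N ^ 1)) : (i : ℕ) < 10 := i.isLt

theorem mul_add_lt_side (i : Fin (N ^ k)) (a : Fin (N ^ 1)) : N * (i : ℕ) + a < N ^ (k + 1) := by
  have h : N ^ (k + 1) = N * N ^ k := pow_succ' N k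
  have hi : N * ((i : ℕ) + 1) ≤ N * N ^ k := Nat.mul_le_mul_left _ i.isLt
  have ha := pos_lt a
  rw [h]
  simp only [N] at *
  omega

/-- The node of `G(p)` at the position `a`. -/
def nodeAt (p : Node k) (a : Node 1) : Node (k + 1) :=
  (⟨N * p.1 + a.1, mul_add_lt_side _ _⟩, ⟨N * p.2 + a.2, mul_add_lt_side _ _⟩)

@[simp] theorem macroOf_nodeAt (p : Node k) (a : Node 1) : macroOf (nodeAt p a) = p := by
  have h1 := pos_lt a.1
  have h2 := pos_lt a.2
  ext <;> simp only [macroOf, nodeAt, N] <;> omega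

@[simp] theorem posIn_nodeAt (p : Node k) (a : Node 1) : posIn (nodeAt p a) = a := by
  have h1 := pos_lt a.1
  have h2 := pos_lt a.2
  ext <;> simp only [posIn, nodeAt, N] <;> omega

@[simp] theorem nodeAt_macroOf_posIn (v : Node (k + 1)) : nodeAt (macroOf v) (posIn v) = v := by
  ext <;> simp only [macroOf, posIn, nodeAt, N] <;> omega

theorem eq_nodeAt {v : Node (k + 1)} {p : Node k} {a : Node 1} (h : macroOf v = p)
    (h' : posIn v = a) : v = nodeAt p a := by
  subst h h'; simp

theorem mem_corrIn {Corr : Set (Node (k + 1))} {p : Node k} {a : Node 1} :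
    a ∈ corrIn Corr p ↔ nodeAt p a ∈ Corr := by
  constructor
  · rintro ⟨v, hv, hp, ha⟩
    rwa [← eq_nodeAt hp ha]
  · exact fun h => ⟨_, h, by simp, by simp⟩

theorem adj_iff_nat {m : ℕ} {a b : Fin m × Fin m} : (gridGraph m).Adj a b ↔
    ((a.1 : ℕ) = b.1 ∧ ((a.2 : ℕ) = b.2 + 1 ∨ (b.2 : ℕ) = a.2 + 1)) ∨
    ((a.2 : ℕ) = b.2 ∧ ((a.1 : ℕ) = b.1 + 1 ∨ (b.1 : ℕ) = a.1 + 1)) := by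
  simp only [gridGraph, abs_eq (zero_le_one' ℤ), Fin.ext_iff]
  omega

theorem adj_nodeAt (p : Node k) (a b : Node 1) :
    (gridNet (k + 1)).Adj (nodeAt p a) (nodeAt p b) ↔ (gridNet 1).Adj a b := by
  rw [adj_iff_nat, adj_iff_nat]
  simp only [nodeAt, N]
  omega

/-- The four sides of the `N × N` grid, each enumerated by the coordinate that varies on it. -/
def IsSide (c : Fin (N ^ 1) → Node 1) : Prop :=
  c = (fun t => (⟨0, by decide⟩, t)) ∨ c = (fun t => (⟨9, by decide⟩, t)) ∨
  c = (fun t => (t, ⟨0, by decide⟩)) ∨ c = (fun t => (t, ⟨9, by decide⟩))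

theorem IsSide.injective {c : Fin (N ^ 1) → Node 1} (hc : IsSide c) : c.Injective := by
  rintro s t h
  rcases hc with rfl | rfl | rfl | rfl <;> simpa using h

/-- On each side of a correct grid, more than `3 N / 4` nodes are reliable. -/
theorem IsSide.lt_ncard {c : Fin (N ^ 1) → Node 1} (hc : IsSide c)
    {Rel₁ : Set (Node 1) → Set (Node 1)} {C : Set (Node 1)} (h : IsCorrectMacroNode Rel₁ C) :
    3 * N < 4 * {t | c t ∈ Rel₁ C}.ncard := by
  have key : ∀ S : Set (Node 1), 3 * N < 4 * S.ncard → S ⊆ c '' {t | c t ∈ Rel₁ C} →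
      3 * N < 4 * {t | c t ∈ Rel₁ C}.ncard := fun S hS hsub => by
    have h1 := Set.ncard_le_ncard hsub (Set.toFinite _)
    have h2 := Set.ncard_image_le (f := c) (Set.toFinite {t | c t ∈ Rel₁ C})
    omega
  obtain ⟨h1, h2, h3, h4⟩ := h
  rcases hc with rfl | rfl | rfl | rfl
  · exact key _ h1 fun a ha => ⟨a.2, by
      have e : ((⟨0, by decide⟩, a.2) : Node 1) = a := Prod.ext (Fin.ext ha.2.symm) rfl
      exact ⟨by simpa only [Set.mem_ofPred_eq, e] using ha.1, e⟩⟩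
  · exact key _ h2 fun a ha => ⟨a.2, by
      have e : ((⟨9, by decide⟩, a.2) : Node 1) = a := Prod.ext (Fin.ext ha.2.symm) rfl
      exact ⟨by simpa only [Set.mem_ofPred_eq, e] using ha.1, e⟩⟩
  · exact key _ h3 fun a ha => ⟨a.1, by
      have e : ((a.1, ⟨0, by decide⟩) : Node 1) = a := Prod.ext rfl (Fin.ext ha.2.symm)
      exact ⟨by simpa only [Set.mem_ofPred_eq, e] using ha.1, e⟩⟩
  · exact key _ h4 fun a ha => ⟨a.1, by
      have e : ((a.1, ⟨9, by decide⟩) : Node 1) = a := Prod.ext rfl (Fin.ext ha.2.symm)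
      exact ⟨by simpa only [Set.mem_ofPred_eq, e] using ha.1, e⟩⟩

/-- Neighboring macro-nodes face each other along two sides. -/
theorem exists_facing_sides {p q : Node k} (h : (gridNet k).Adj p q) :
    ∃ c c' : Fin (N ^ 1) → Node 1, IsSide c ∧ IsSide c' ∧
      ∀ a b, (gridNet (k + 1)).Adj (nodeAt p a) (nodeAt q b) ↔ ∃ t, a = c t ∧ b = c' t := by
  rw [adj_iff_nat] at h
  rcases h with ⟨h, h' | h'⟩ | ⟨h, h' | h'⟩
  -- The macro-node with the larger coordinate contributes its side at `0`, the other its side at `9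
  -- = N - 1`. A link is indexed by the coordinate its two ends share.
  · refine ⟨_, _, .inr (.inr (.inl rfl)), .inr (.inr (.inr rfl)), fun a b => ?_⟩
    have h1 := pos_lt a.1; have h2 := pos_lt a.2; have h3 := pos_lt b.1; have h4 := pos_lt b.2
    simp only [adj_iff_nat, nodeAt, N, Prod.ext_iff, Fin.ext_iff]
    exact ⟨fun _ => ⟨a.1, by omega⟩, fun ⟨t, _⟩ => by omega⟩
  · refine ⟨_, _, .inr (.inr (.inr rfl)), .inr (.inr (.inl rfl)), fun a b => ?_⟩
    have h1 := pos_lt a.1; have h2 := pos_lt a.2; have h3 := pos_lt b.1; have h4 := pos_lt b.2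
    simp only [adj_iff_nat, nodeAt, N, Prod.ext_iff, Fin.ext_iff]
    exact ⟨fun _ => ⟨a.1, by omega⟩, fun ⟨t, _⟩ => by omega⟩
  · refine ⟨_, _, .inl rfl, .inr (.inl rfl), fun a b => ?_⟩
    have h1 := pos_lt a.1; have h2 := pos_lt a.2; have h3 := pos_lt b.1; have h4 := pos_lt b.2
    simp only [adj_iff_nat, nodeAt, N, Prod.ext_iff, Fin.ext_iff]
    exact ⟨fun _ => ⟨a.2, by omega⟩, fun ⟨t, _⟩ => by omega⟩
  · refine ⟨_, _, .inr (.inl rfl), .inl rfl, fun a b => ?_⟩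
    have h1 := pos_lt a.1; have h2 := pos_lt a.2; have h3 := pos_lt b.1; have h4 := pos_lt b.2
    simp only [adj_iff_nat, nodeAt, N, Prod.ext_iff, Fin.ext_iff]
    exact ⟨fun _ => ⟨a.2, by omega⟩, fun ⟨t, _⟩ => by omega⟩

/-- Pigeonhole on the `N` positions of a side, used both to find links reliable at both ends and to
intersect majorities. -/
theorem ncard_add_le_ncard_inter_add (A B : Set (Fin (N ^ 1))) :
    A.ncard + B.ncard ≤ (A ∩ B).ncard + N := by
  have h1 := Set.ncard_union_add_ncard_inter A B (Set.toFinite _) (Set.toFinite _)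
  have h2 : (A ∪ B).ncard ≤ N := by
    simpa [Set.ncard_univ] using Set.ncard_le_ncard (Set.subset_univ (A ∪ B)) (Set.toFinite _)
  omega

end Geometry

/-! ### Macro-channels -/

section Channels

variable {k : ℕ} {Rel₁ : Set (Node 1) → Set (Node 1)} {C D : Set (Node 1)}
  {c c' : Fin (N ^ 1) → Node 1}

/-- More than half of the links between two correct macro-nodes join reliable nodes. -/
theorem lt_ncard_reliable_links (hc : IsSide c) (hc' : IsSide c')
    (hC : IsCorrectMacroNode Rel₁ C) (hD : IsCorrectMacroNode Rel₁ D) :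
    N < 2 * {t | c t ∈ Rel₁ C ∧ c' t ∈ Rel₁ D}.ncard := by
  have h1 := hc.lt_ncard hC
  have h2 := hc'.lt_ncard hD
  -- Two sets of more than `3N/4` positions among `N` share more than `3N/4 + 3N/4 - N = N/2`.
  have h3 : _ ≤ {t | c t ∈ Rel₁ C ∧ c' t ∈ Rel₁ D}.ncard + N :=
    ncard_add_le_ncard_inter_add {t | c t ∈ Rel₁ C} {t | c' t ∈ Rel₁ D}
  omega

/-- A majority of the border contains the end of a link between reliable nodes. -/
theorem exists_reliable_link_mem {p q : Node k} (hc : IsSide c) (hc' : IsSide c')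
    (hadj : ∀ a b, (gridNet (k + 1)).Adj (nodeAt p a) (nodeAt q b) ↔ ∃ t, a = c t ∧ b = c' t)
    (hC : IsCorrectMacroNode Rel₁ C) (hD : IsCorrectMacroNode Rel₁ D)
    {W : List (Node (k + 1))} (hnodup : W.Nodup) (hW : ∀ w ∈ W, w ∈ macroBorder p q)
    (hmaj : N < 2 * W.length) :
    ∃ t, c t ∈ Rel₁ C ∧ c' t ∈ Rel₁ D ∧ nodeAt p (c t) ∈ W := by
  have h1 := lt_ncard_reliable_links hc hc' hC hD
  -- A border node has a neighbor in `G(q)`, hence lies on the side `c`; distinct voters therefore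
  -- give distinct positions.
  have h2 : W.length ≤ {t | nodeAt p (c t) ∈ W}.ncard := by
    classical
    have hsub : (W.toFinset : Set (Node (k + 1))) ⊆
        (fun t => nodeAt p (c t)) '' {t | nodeAt p (c t) ∈ W} := by
      intro w hw
      have hw : w ∈ W := by simpa using hw
      obtain ⟨hp, w', hww', hq⟩ := hW w hw
      rw [eq_nodeAt hp rfl, eq_nodeAt hq rfl] at hww'
      obtain ⟨t, ht, -⟩ := (hadj _ _).1 hww'
      have e : nodeAt p (c t) = w := ht ▸ (eq_nodeAt hp rfl).symm
      exact ⟨t, show nodeAt p (c t) ∈ W by rwa [e], e⟩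
    have h3 := Set.ncard_le_ncard hsub (Set.toFinite _)
    have h4 := Set.ncard_image_le (f := fun t => nodeAt p (c t))
      (Set.toFinite {t | nodeAt p (c t) ∈ W})
    rw [Set.ncard_coe_finset, List.toFinset_card_of_nodup hnodup] at h3
    omega
  have h3 := ncard_add_le_ncard_inter_add {t | c t ∈ Rel₁ C ∧ c' t ∈ Rel₁ D}
    {t | nodeAt p (c t) ∈ W}
  have h4 : ({t | c t ∈ Rel₁ C ∧ c' t ∈ Rel₁ D} ∩ {t | nodeAt p (c t) ∈ W}).Nonempty := by
    rw [← Set.ncard_pos (Set.toFinite _)]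
    omega
  obtain ⟨t, ⟨h5, h6⟩, h7⟩ := h4
  exact ⟨t, h5, h6, h7⟩

/-- The ends in `G(p)` of the links between reliable nodes form a majority of the border. -/
theorem exists_reliable_majority {p q : Node k} (hpq : (gridNet k).Adj p q)
    (hC : IsCorrectMacroNode Rel₁ C) (hD : IsCorrectMacroNode Rel₁ D) :
    ∃ W : List (Node (k + 1)), W.Nodup ∧ N < 2 * W.length ∧ (∀ w ∈ W, w ∈ macroBorder p q) ∧
      ∀ w ∈ W, posIn w ∈ Rel₁ C ∧ ∃ b ∈ Rel₁ D, (gridNet (k + 1)).Adj (nodeAt q b) w := by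
  obtain ⟨c, c', hc, hc', hadj⟩ := exists_facing_sides hpq
  have hfin := Set.toFinite {t | c t ∈ Rel₁ C ∧ c' t ∈ Rel₁ D}
  have h1 := lt_ncard_reliable_links hc hc' hC hD
  rw [Set.ncard_eq_toFinset_card _ hfin] at h1
  have hinj : Function.Injective fun t => nodeAt p (c t) := fun s t hst =>
    hc.injective (by simpa using congrArg posIn hst)
  refine ⟨hfin.toFinset.toList.map fun t => nodeAt p (c t), (Finset.nodup_toList _).map hinj,
    by simpa using h1, fun w hw => ?_, fun w hw => ?_⟩
  · obtain ⟨t, -, rfl⟩ := List.mem_map.1 hw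
    exact ⟨by simp, nodeAt q (c' t), (hadj _ _).2 ⟨t, rfl, rfl⟩, by simp⟩
  · obtain ⟨t, ht, rfl⟩ := List.mem_map.1 hw
    have ht : c t ∈ Rel₁ C ∧ c' t ∈ Rel₁ D := by simpa using ht
    exact ⟨by simpa using ht.1, c' t, ht.2, ((hadj _ _).2 ⟨t, rfl, rfl⟩).symm⟩

end Channels

/-! ### Runs -/

section Runs

variable {V M : Type} {G : SimpleGraph V} {P : Protocol V M} {Corr : Set V}
  {σ : ℕ → V → Set P.F}

theorem IsRun.subset_of_le (hσ : IsRun G P Corr σ) {v : V} (hv : v ∈ Corr) {m n : ℕ}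
    (hmn : m ≤ n) : σ m v ⊆ σ n v :=
  monotone_nat_of_le_succ (f := fun n => σ n v) (hσ.mono v hv) hmn

/-- The run axiom constrains only the step at which a fact appears. Memory starts empty and grows,
so that step exists and its premises persist. -/
theorem IsRun.exists_rule (hσ : IsRun G P Corr σ) {v : V} (hv : v ∈ Corr) {n : ℕ} {a}
    (h : NodeFact.did a ∈ σ n v) : ∃ X, P.rule v X a ∧ ∀ f ∈ X, f ∈ σ n v := by
  induction n with
  | zero => simp [hσ.init v hv] at h
  | succ n ih =>
    by_cases h' : NodeFact.did a ∈ σ n v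
    · obtain ⟨X, hX, hf⟩ := ih h'
      exact ⟨X, hX, fun f hfX => hσ.mono v hv n (hf f hfX)⟩
    · obtain ⟨X, hX, hf⟩ := hσ.act v hv n a h h'
      exact ⟨X, hX, fun f hfX => hσ.mono v hv n (hf f hfX)⟩

theorem IsRun.of_recv_mem (hσ : IsRun G P Corr σ) {u v : V} (hv : v ∈ Corr) {n : ℕ} {x : P.Msg}
    (h : NodeFact.recv u x ∈ σ n v) :
    G.Adj u v ∧ (u ∈ Corr → NodeFact.did (NodeAction.send v x) ∈ σ n u) := by
  induction n with
  | zero => simp [hσ.init v hv] at h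
  | succ n ih =>
    by_cases h' : NodeFact.recv u x ∈ σ n v
    · exact ⟨(ih h').1, fun hu => hσ.mono u hu n ((ih h').2 hu)⟩
    · obtain ⟨h1, h2⟩ := hσ.recv v hv n u x h h'
      exact ⟨h1, fun hu => hσ.mono u hu n (h2 hu)⟩

/-- Finitely many facts that eventually hold eventually hold together. -/
theorem IsRun.exists_forall_mem (hσ : IsRun G P Corr σ) {ι : Type*} (X : List ι) (f : ι → P.F)
    {v : V} (hv : v ∈ Corr) (h : ∀ i ∈ X, ∃ n, f i ∈ σ n v) : ∃ n, ∀ i ∈ X, f i ∈ σ n v := by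
  induction X with
  | nil => exact ⟨0, by simp⟩
  | cons i X ih =>
    obtain ⟨n, hn⟩ := ih fun j hj => h j (List.mem_cons_of_mem _ hj)
    obtain ⟨m, hm⟩ := h i List.mem_cons_self
    refine ⟨max m n, List.forall_mem_cons.2
      ⟨hσ.subset_of_le hv (le_max_left _ _) hm, fun j hj => ?_⟩⟩
    exact hσ.subset_of_le hv (le_max_right _ _) (hn j hj)

/-- Fairness asks for the premises at a single time; growing memory turns separate times into a
common one. -/
theorem IsFair.fire_map (hσ : IsRun G P Corr σ) (hfair : IsFair G P Corr σ) {ι : Type*}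
    {X : List ι} {f : ι → P.F} {v : V} (hv : v ∈ Corr) {a} (hr : P.rule v (X.map f) a)
    (h : ∀ i ∈ X, ∃ n, f i ∈ σ n v) : ∃ n, NodeFact.did a ∈ σ n v := by
  obtain ⟨n, hn⟩ := hσ.exists_forall_mem X f hv h
  exact hfair.fire v hv _ _ hr n (by simpa using hn)

/-- The run in which the nodes outside `Corr` are silent, every message is delivered and every
rule is applied at once, and the node `v` broadcasts the messages of `I v` at time `1`. -/
def syncRun (G : SimpleGraph V) (P : Protocol V M) (Corr : Set V) (I : V → Set M) :
    ℕ → V → Set P.F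
  | 0, _ => ∅
  | n + 1, v => {f | f ∈ syncRun G P Corr I n v ∨
      match f with
      | .input m => m ∈ I v
      | .recv u x => u ∈ Corr ∧ G.Adj u v ∧
          NodeFact.did (NodeAction.send v x) ∈ syncRun G P Corr I n u
      | .did a => ∃ X, P.rule v X a ∧ ∀ f ∈ X, f ∈ syncRun G P Corr I n v}

/-- Runs leave broadcast requests unconstrained after time `0` and allow Byzantine silence, so `I`
can be arbitrary. -/
theorem isRun_syncRun (I : V → Set M) : IsRun G P Corr (syncRun G P Corr I) where
  init _ _ := rfl
  mono _ _ _ _ hf := Or.inl hf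
  recv _ _ _ _ _ h h' := by
    obtain ⟨_, h2, h3⟩ := h.resolve_left h'
    exact ⟨h2, fun _ => h3⟩
  act _ _ _ _ h h' := h.resolve_left h'

theorem isFair_syncRun (I : V → Set M) : IsFair G P Corr (syncRun G P Corr I) where
  deliver _ hu _ _ huv n _ h := ⟨n + 1, Or.inr ⟨hu, huv, h⟩⟩
  fire _ _ X _ hX n h := ⟨n + 1, Or.inr ⟨X, hX, h⟩⟩

/-- The run `syncRun` only contains what is derivable. -/
theorem syncRun_subset (I : V → Set M) (A : V → Set P.F)
    (hinput : ∀ v ∈ Corr, ∀ m ∈ I v, NodeFact.input m ∈ A v)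
    (hrecv : ∀ u ∈ Corr, ∀ v ∈ Corr, G.Adj u v → ∀ x,
      NodeFact.did (NodeAction.send v x) ∈ A u → NodeFact.recv u x ∈ A v)
    (hdid : ∀ v ∈ Corr, ∀ X a, P.rule v X a → (∀ f ∈ X, f ∈ A v) → NodeFact.did a ∈ A v)
    (n : ℕ) : ∀ v ∈ Corr, syncRun G P Corr I n v ⊆ A v := by
  induction n with
  | zero => exact fun v _ => Set.empty_subset _
  | succ n ih =>
    rintro v hv f (hf | hf)
    · exact ih v hv hf
    · match f, hf with
      | .input m, hm => exact hinput v hv m hm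
      | .recv u x, ⟨hu, huv, h⟩ => exact hrecv u hu v hv huv x (ih u hu h)
      | .did a, ⟨X, hX, h⟩ => exact hdid v hv X a hX fun f hf => ih v hv (h f hf)

end Runs

/-! ### One level of the hierarchy -/

section HierStep

variable {k : ℕ} {M : Type} {P : Protocol (Node k) (Node (k + 1) × M)}
  {L : Protocol (Node 1) (LocalContent k M P.Msg)}

/-- The protocol on `G_{k+1}` made from `P` on `G_k` and from the local protocol `L`. -/
abbrev hierProtocol (P : Protocol (Node k) (Node (k + 1) × M))
    (L : Protocol (Node 1) (LocalContent k M P.Msg)) : Protocol (Node (k + 1)) M where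
  Msg := HierMsg P L
  Item := HierItem P L
  rule := HierRule P L

open NodeFact NodeAction

variable {v : Node (k + 1)}
  {X : List (NodeFact (Node (k + 1)) M (HierMsg P L) (HierItem P L))}

/-- This inversion and the following ones hold because each kind of conclusion is produced by
exactly one rule. They are what allows facts to be traced back to their causes. -/
theorem HierRule.of_loc_did {a} (h : HierRule P L v X (add (.inl (did a)))) :
    ∃ Y : List L.F, L.rule (posIn v) Y a ∧ X = Y.map loc := by
  cases h with
  | locStep Y _ h => exact ⟨Y, h, rfl⟩

theorem HierRule.of_loc_recv {b x} (h : HierRule P L v X (add (.inl (recv b x)))) :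
    ∃ w, macroOf w = macroOf v ∧ b = posIn w ∧ X = [recv w (.inl x)] := by
  cases h with
  | locRecv w _ hw => exact ⟨w, hw, rfl, rfl⟩

theorem HierRule.of_send_loc {w x} (h : HierRule P L v X (send w (.inl x))) :
    X = [loc (did (send (posIn w) x))] := by
  cases h with
  | locSend _ _ hw => rfl

theorem HierRule.of_send_chan {w x} (h : HierRule P L v X (send w (.inr x))) :
    X = [sim (did (send (macroOf w) x))] := by
  cases h with
  | chanSend _ _ hw => rfl

theorem HierRule.of_loc_input_chan {q x}
    (h : HierRule P L v X (add (.inl (input (.inr (q, x)))))) :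
    ∃ w, macroOf w = q ∧ X = [recv w (.inr x)] := by
  cases h with
  | chanRecv w _ hadj => exact ⟨w, rfl, rfl⟩

theorem HierRule.of_loc_input {m} (h : HierRule P L v X (add (.inl (input (.inl m))))) :
    X = [input m] := by
  cases h with
  | start m => rfl

theorem HierRule.of_sim_did {a} (h : HierRule P L v X (add (.inr (did a)))) :
    ∃ Y : List P.F, P.rule (macroOf v) Y a ∧ X = Y.map sim := by
  cases h with
  | simStep Y _ h => exact ⟨Y, h, rfl⟩

theorem HierRule.of_sim_recv {p x} (h : HierRule P L v X (add (.inr (recv p x)))) :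
    (gridNet k).Adj p (macroOf v) ∧ ∃ W : List (Node (k + 1)), W.Nodup ∧
      (∀ w ∈ W, w ∈ macroBorder (macroOf v) p) ∧ N < 2 * W.length ∧
      X = W.map fun w => loc (did (accept (posIn w) (.inr (p, x)))) := by
  cases h with
  | chanVote _ _ hadj W h1 h2 h3 => exact ⟨hadj, W, h1, h2, h3, rfl⟩

theorem HierRule.of_sim_input {s m} (h : HierRule P L v X (add (.inr (input (s, m))))) :
    macroOf s = macroOf v ∧ X = [loc (did (accept (posIn s) (.inl m)))] := by
  cases h with
  | simInput _ _ hs => exact ⟨hs, rfl⟩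

theorem HierRule.of_accept {s m} (h : HierRule P L v X (accept s m)) :
    X = [sim (did (accept (macroOf s) (s, m)))] := by
  cases h with
  | finish _ _ => rfl

variable {Corr : Set (Node (k + 1))} {σ : ℕ → Node (k + 1) → Set (hierProtocol P L).F}

/-- The memories of the local protocol in the macro-node `G(p)`. -/
def localView (σ : ℕ → Node (k + 1) → Set (hierProtocol P L).F) (p : Node k) :
    ℕ → Node 1 → Set L.F :=
  fun n a => {f | loc f ∈ σ n (nodeAt p a)}

/-- Local messages are accepted only from the same macro-node, and a correct node sends one only
when its local protocol does. The rest of the network is thus invisible to the local run. -/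
theorem isRun_localView (hσ : IsRun (gridNet (k + 1)) (hierProtocol P L) Corr σ) (p : Node k) :
    IsRun (gridNet 1) L (corrIn Corr p) (localView σ p) where
  init a ha := by
    ext f
    simp [localView, hσ.init _ (mem_corrIn.1 ha)]
  mono a ha n f hf := hσ.mono _ (mem_corrIn.1 ha) n hf
  recv a ha n b x h h' := by
    obtain ⟨X, hX, hm⟩ := hσ.act _ (mem_corrIn.1 ha) n _ h h'
    obtain ⟨w, hw, rfl, rfl⟩ := HierRule.of_loc_recv hX
    obtain ⟨hadj, hsend⟩ := hσ.of_recv_mem (mem_corrIn.1 ha) (hm _ List.mem_cons_self)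
    have hw' : w = nodeAt p (posIn w) := eq_nodeAt (by simpa using hw) rfl
    refine ⟨(adj_nodeAt p _ _).1 (hw' ▸ hadj), fun hb => ?_⟩
    have hc : w ∈ Corr := hw' ▸ mem_corrIn.1 hb
    obtain ⟨Y, hY, hm⟩ := hσ.exists_rule hc (hsend hc)
    obtain rfl := HierRule.of_send_loc hY
    have := hm _ List.mem_cons_self
    rw [posIn_nodeAt] at this
    show _ ∈ σ n (nodeAt p (posIn w))
    rwa [← hw']
  act a ha n b h h' := by
    obtain ⟨X, hX, hm⟩ := hσ.act _ (mem_corrIn.1 ha) n _ h h'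
    obtain ⟨Y, hY, rfl⟩ := HierRule.of_loc_did hX
    rw [posIn_nodeAt] at hY
    exact ⟨Y, hY, fun f hf => hm _ (List.mem_map_of_mem hf)⟩

theorem isFair_localView (hfair : IsFair (gridNet (k + 1)) (hierProtocol P L) Corr σ) (p : Node k) :
    IsFair (gridNet 1) L (corrIn Corr p) (localView σ p) where
  deliver a ha b hb hab n x h := by
    rw [mem_corrIn] at ha hb
    have hs : HierRule P L (nodeAt p a) [loc (did (send (posIn (nodeAt p b)) x))]
      (send (nodeAt p b) (.inl x)) := .locSend _ x (by simp)
    have hr : HierRule P L (nodeAt p b) [recv (nodeAt p a) (.inl x)]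
      (add (.inl (recv (posIn (nodeAt p a)) x))) := .locRecv _ x (by simp)
    rw [posIn_nodeAt] at hs hr
    obtain ⟨n₁, h₁⟩ := hfair.fire _ ha _ _ hs n (List.forall_mem_singleton.2 h)
    obtain ⟨n₂, h₂⟩ := hfair.deliver _ ha _ hb ((adj_nodeAt p a b).2 hab) n₁ _ h₁
    exact hfair.fire _ hb _ _ hr n₂ (by simpa using h₂)
  fire a ha X b hX n h := by
    have hr : HierRule P L (nodeAt p a) (X.map loc) (add (.inl (did b))) :=
      .locStep X b (by simpa using hX)
    exact hfair.fire _ (mem_corrIn.1 ha) _ _ hr n (by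
      intro f hf
      obtain ⟨g, hg, rfl⟩ := List.mem_map.1 hf
      exact h g hg)

variable {Rel₁ : Set (Node 1) → Set (Node 1)}

theorem nodeAt_mem_of_reliable
    (hL : ∀ C : Set (Node 1), IsReliable (gridNet 1) L C (Rel₁ C)) {p : Node k} {a : Node 1}
    (ha : a ∈ Rel₁ (corrIn Corr p)) : nodeAt p a ∈ Corr :=
  mem_corrIn.1 ((hL _).1 ha)

/-- The facts that hold in the simulation of `p` at some reliable node of `G(p)`. -/
def simUnion (Rel₁ : Set (Node 1) → Set (Node 1)) (Corr : Set (Node (k + 1)))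
    (σ : ℕ → Node (k + 1) → Set (hierProtocol P L).F) : ℕ → Node k → Set P.F :=
  fun n p => {f | ∃ a ∈ Rel₁ (corrIn Corr p), sim f ∈ σ n (nodeAt p a)}

/-- A fact new in the union is new at some reliable node, which had a rule for it. Only receptions
need an argument: the vote behind one includes a link with two reliable ends. -/
theorem isRun_simUnion (hL : ∀ C : Set (Node 1), IsReliable (gridNet 1) L C (Rel₁ C))
    (hσ : IsRun (gridNet (k + 1)) (hierProtocol P L) Corr σ) :
    IsRun (gridNet k) P {p | IsCorrectMacroNode Rel₁ (corrIn Corr p)}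
      (simUnion Rel₁ Corr σ) where
  init p _ := by
    refine Set.eq_empty_iff_forall_notMem.2 ?_
    rintro f ⟨a, ha, hf⟩
    simp [hσ.init _ (nodeAt_mem_of_reliable hL ha)] at hf
  mono p _ n := by
    rintro f ⟨a, ha, hf⟩
    exact ⟨a, ha, hσ.mono _ (nodeAt_mem_of_reliable hL ha) n hf⟩
  recv p hp n q x h h' := by
    obtain ⟨a, ha, hf⟩ := h
    have hac := nodeAt_mem_of_reliable hL ha
    obtain ⟨X, hX, hm⟩ := hσ.act _ hac n _ hf fun h => h' ⟨a, ha, h⟩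
    obtain ⟨hqp, W, hnodup, hW, hmaj, rfl⟩ := HierRule.of_sim_recv hX
    rw [macroOf_nodeAt] at hqp hW
    refine ⟨hqp, fun hq => ?_⟩
    obtain ⟨c, c', hc, hc', hadj⟩ := exists_facing_sides hqp.symm
    obtain ⟨t, ht, ht', htW⟩ := exists_reliable_link_mem hc hc' hadj hp hq hnodup hW hmaj
    have hacc := hm _ (List.mem_map_of_mem htW)
    rw [posIn_nodeAt] at hacc
    -- Both `a` and `c t` are locally reliable, so the vote attributed to `c t` was really broadcast
    -- by it.
    have hin : loc (input (.inr (q, x))) ∈ σ n (nodeAt p (c t)) :=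
      (((hL _).2 _ ht a ha (.inr (q, x))).2 _ (isRun_localView hσ p) n) hacc
    obtain ⟨Y, hY, hm⟩ := hσ.exists_rule (nodeAt_mem_of_reliable hL ht) hin
    obtain ⟨w, hw, rfl⟩ := HierRule.of_loc_input_chan hY
    obtain ⟨hadjw, hsend⟩ :=
      hσ.of_recv_mem (nodeAt_mem_of_reliable hL ht) (hm _ List.mem_cons_self)
    rw [eq_nodeAt hw rfl] at hadjw hsend
    -- The node `c t` has only one neighbor in `G(q)`, the other end `c' t` of the link, which is
    -- reliable and so sent `x` because its simulation did.
    obtain ⟨t', h1, h2⟩ := (hadj _ _).1 hadjw.symm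
    obtain rfl := hc.injective h1
    rw [h2] at hsend
    have hwc := nodeAt_mem_of_reliable hL ht'
    obtain ⟨Z, hZ, hm⟩ := hσ.exists_rule hwc (hsend hwc)
    obtain rfl := HierRule.of_send_chan hZ
    have := hm _ List.mem_cons_self
    rw [macroOf_nodeAt] at this
    exact ⟨_, ht', this⟩
  act p _ n b h h' := by
    obtain ⟨a, ha, hf⟩ := h
    obtain ⟨X, hX, hm⟩ :=
      hσ.act _ (nodeAt_mem_of_reliable hL ha) n _ hf fun h => h' ⟨a, ha, h⟩
    obtain ⟨Y, hY, rfl⟩ := HierRule.of_sim_did hX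
    rw [macroOf_nodeAt] at hY
    exact ⟨Y, hY, fun f hf => ⟨a, ha, hm _ (List.mem_map_of_mem hf)⟩⟩

/-- The facts that eventually hold in the simulation of `p` at all reliable nodes of `G(p)`. -/
def simEventually (Rel₁ : Set (Node 1) → Set (Node 1)) (Corr : Set (Node (k + 1)))
    (σ : ℕ → Node (k + 1) → Set (hierProtocol P L).F) (p : Node k) : Set P.F :=
  {f | ∀ a ∈ Rel₁ (corrIn Corr p), ∃ n, sim f ∈ σ n (nodeAt p a)}

/-- Every link reliable at both ends carries `x` across, its receiving end broadcasts it, and local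
liveness brings these votes to each reliable node. They form a majority. -/
theorem recv_mem_simEventually
    (hL : ∀ C : Set (Node 1), IsReliable (gridNet 1) L C (Rel₁ C))
    (hσ : IsRun (gridNet (k + 1)) (hierProtocol P L) Corr σ)
    (hfair : IsFair (gridNet (k + 1)) (hierProtocol P L) Corr σ) {p q : Node k}
    (hp : IsCorrectMacroNode Rel₁ (corrIn Corr p)) (hq : IsCorrectMacroNode Rel₁ (corrIn Corr q))
    (hqp : (gridNet k).Adj q p) {x : P.Msg}
    (hx : did (send p x) ∈ simEventually Rel₁ Corr σ q) :
    recv q x ∈ simEventually Rel₁ Corr σ p := by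
  intro a ha
  have hac := nodeAt_mem_of_reliable hL ha
  obtain ⟨W, hnodup, hmaj, hborder, hW⟩ := exists_reliable_majority hqp.symm hp hq
  have hr : HierRule P L (nodeAt p a)
      (W.map fun w => loc (did (accept (posIn w) (.inr (q, x))))) (add (.inr (recv q x))) :=
    .chanVote q x (by simpa using hqp) W hnodup (by simpa using hborder) hmaj
  refine hfair.fire_map hσ hac hr fun w hw => ?_
  obtain ⟨hw₁, b, hb, hadj⟩ := hW w hw
  have hwp : macroOf w = p := (hborder w hw).1
  have hwc : w ∈ Corr := eq_nodeAt hwp rfl ▸ nodeAt_mem_of_reliable hL hw₁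
  have hbc := nodeAt_mem_of_reliable hL hb
  obtain ⟨n₀, h₀⟩ := hx b hb
  have hs : HierRule P L (nodeAt q b) [sim (did (send (macroOf w) x))] (send w (.inr x)) :=
    .chanSend w x hadj (by simpa [hwp] using hqp)
  rw [hwp] at hs
  obtain ⟨n₁, h₁⟩ := hfair.fire _ hbc _ _ hs n₀ (by simpa using h₀)
  obtain ⟨n₂, h₂⟩ := hfair.deliver _ hbc _ hwc hadj n₁ _ h₁
  have hr' : HierRule P L w [recv (nodeAt q b) (.inr x)]
      (add (.inl (input (.inr (macroOf (nodeAt q b), x))))) :=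
    .chanRecv _ x (by simpa [hwp] using hqp)
  rw [macroOf_nodeAt] at hr'
  obtain ⟨n₃, h₃⟩ := hfair.fire _ hwc _ _ hr' n₂ (by simpa using h₂)
  rw [eq_nodeAt hwp rfl] at h₃
  exact ((hL _).2 _ hw₁ a ha (.inr (q, x))).1 _ (isRun_localView hσ p)
    (isFair_localView hfair p) n₃ h₃

/-- Each reliable node holds all the premises in its own copy and fires the rule there; this is
where quantifying over all reliable nodes, not just one, is needed. -/
theorem did_mem_simEventually
    (hL : ∀ C : Set (Node 1), IsReliable (gridNet 1) L C (Rel₁ C))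
    (hσ : IsRun (gridNet (k + 1)) (hierProtocol P L) Corr σ)
    (hfair : IsFair (gridNet (k + 1)) (hierProtocol P L) Corr σ) {p : Node k} {X : List P.F} {b}
    (hX : P.rule p X b) (h : ∀ f ∈ X, f ∈ simEventually Rel₁ Corr σ p) :
    did b ∈ simEventually Rel₁ Corr σ p := by
  intro a ha
  have hr : HierRule P L (nodeAt p a) (X.map sim) (add (.inr (did b))) :=
    .simStep X b (by simpa using hX)
  exact hfair.fire_map hσ (nodeAt_mem_of_reliable hL ha) hr fun f hf => h f hf a ha

theorem input_mem_simEventually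
    (hL : ∀ C : Set (Node 1), IsReliable (gridNet 1) L C (Rel₁ C))
    (hσ : IsRun (gridNet (k + 1)) (hierProtocol P L) Corr σ)
    (hfair : IsFair (gridNet (k + 1)) (hierProtocol P L) Corr σ) {s : Node (k + 1)}
    (hs : posIn s ∈ Rel₁ (corrIn Corr (macroOf s))) {m : M} {n : ℕ} (h : input m ∈ σ n s) :
    input (s, m) ∈ simEventually Rel₁ Corr σ (macroOf s) := by
  intro a ha
  have hsc := nodeAt_mem_of_reliable hL hs
  obtain ⟨n₁, h₁⟩ := hfair.fire _ (by simpa using hsc) [input m] _ (.start m) n (by simpa using h)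
  obtain ⟨n₂, h₂⟩ := ((hL _).2 _ hs a ha (.inl m)).1 _ (isRun_localView hσ (macroOf s))
    (isFair_localView hfair _) n₁ (by simpa [localView] using h₁)
  exact hfair.fire _ (nodeAt_mem_of_reliable hL ha)
    [loc (did (accept (posIn s) (.inl m)))] _ (.simInput s m (by simp)) n₂
    (List.forall_mem_singleton.2 h₂)

/-- If `R` is reliable for `P` when the correct nodes are those whose macro-node is correct, the
reliable nodes of the macro-nodes in `R` are reliable for `hierProtocol P L`. -/
theorem isReliable_hierProtocol
    (hL : ∀ C : Set (Node 1), IsReliable (gridNet 1) L C (Rel₁ C)) {R : Set (Node k)}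
    (hR : IsReliable (gridNet k) P {p | IsCorrectMacroNode Rel₁ (corrIn Corr p)} R) :
    IsReliable (gridNet (k + 1)) (hierProtocol P L) Corr
      {v | macroOf v ∈ R ∧ posIn v ∈ Rel₁ (corrIn Corr (macroOf v))} := by
  have hcorr : ∀ v : Node (k + 1), posIn v ∈ Rel₁ (corrIn Corr (macroOf v)) → v ∈ Corr :=
    fun v hv => by simpa using nodeAt_mem_of_reliable hL hv
  refine ⟨fun v hv => hcorr v hv.2, fun s ⟨hsR, hs⟩ r ⟨hrR, hr⟩ m =>
    ⟨fun σ hσ hfair n hn => ?_, fun σ hσ n hn => ?_⟩⟩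
  · have hinput := input_mem_simEventually hL hσ hfair hs hn
    -- The comparison run has `(s, m)` as its only broadcast, the one input known to reach all
    -- reliable simulations. Other activity in `σ` can only add facts.
    let I : Node k → Set (Node (k + 1) × M) := fun p => {c | p = macroOf s ∧ c = (s, m)}
    have hI : (s, m) ∈ I (macroOf s) := ⟨rfl, rfl⟩
    have hsub := syncRun_subset (G := gridNet k) (P := P)
      (Corr := {p | IsCorrectMacroNode Rel₁ (corrIn Corr p)})
      I (simEventually Rel₁ Corr σ)
      (by rintro p - c ⟨rfl, rfl⟩; exact hinput)
      (fun q hq p hp hqp x => recv_mem_simEventually hL hσ hfair hp hq hqp)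
      (fun p _ X b => did_mem_simEventually hL hσ hfair)
    -- The inputs of `syncRun` appear at time `1`, its memory at time `0` being empty.
    obtain ⟨n₁, h₁⟩ := (hR.2 _ hsR _ hrR (s, m)).1 _ (isRun_syncRun I) (isFair_syncRun I) 1
      (Or.inr hI)
    obtain ⟨n₂, h₂⟩ := hsub n₁ _ (hR.1 hrR) h₁ _ hr
    rw [nodeAt_macroOf_posIn] at h₂
    exact hfair.fire _ (hcorr r hr) [sim (did (accept (macroOf s) (s, m)))] _ (.finish s m) n₂
      (by simpa using h₂)
  · obtain ⟨X, hX, hm⟩ := hσ.exists_rule (hcorr r hr) hn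
    obtain rfl := HierRule.of_accept hX
    -- Safety of `P` in the union run yields a reliable node `a` of the macro-node of `s`, not
    -- necessarily `s`, whose simulation broadcast `(s, m)`. Local safety then leads from `a` to
    -- `s`.
    obtain ⟨a, ha, h₁⟩ := (hR.2 _ hsR _ hrR (s, m)).2 _ (isRun_simUnion hL hσ) n
      ⟨posIn r, hr, by simpa using hm _ List.mem_cons_self⟩
    obtain ⟨Y, hY, hm⟩ := hσ.exists_rule (nodeAt_mem_of_reliable hL ha) h₁
    obtain ⟨-, rfl⟩ := HierRule.of_sim_input hY
    have h₂ : loc (input (.inl m)) ∈ σ n (nodeAt (macroOf s) (posIn s)) :=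
      ((hL _).2 _ hs a ha (.inl m)).2 _ (isRun_localView hσ _) n (hm _ List.mem_cons_self)
    rw [nodeAt_macroOf_posIn] at h₂
    obtain ⟨Z, hZ, hm⟩ := hσ.exists_rule (hcorr s hs) h₂
    obtain rfl := HierRule.of_loc_input hZ
    exact hm _ List.mem_cons_self

end HierStep

/-- The hierarchical protocol is reliable on `relSet` when its base is on `Rel₁`. -/
theorem isReliable_hierBP (base : (C : Type) → Protocol (Node 1) C)
    (Rel₁ : Set (Node 1) → Set (Node 1))
    (h : ∀ (C : Type) (Corr₀ : Set (Node 1)), IsReliable (gridNet 1) (base C) Corr₀ (Rel₁ Corr₀))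
    (k : ℕ) (M : Type) (Corr : Set (Node (k + 1))) :
    IsReliable (gridNet (k + 1)) (hierBP base k M) Corr (relSet Rel₁ k Corr) := by
  -- The message type must vary because the level below broadcasts pairs of a source and a message.
  induction k generalizing M with
  | zero => exact h M Corr
  | succ k ih => exact isReliable_hierProtocol (h _) (ih _ _)


theorem mainTheorem1 :
    (∀ (base : (C : Type) → Protocol (Node 1) C) (RelBase : Set (Node 1) → Set (Node 1)),
      (∀ (C : Type) (Corr₀ : Set (Node 1)),
        IsReliable (gridNet 1) (base C) Corr₀ (RelBase Corr₀)) →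
      ∀ (k : ℕ) (M : Type) (Corr : Set (Node (k + 1))),
        IsReliable (gridNet (k + 1)) (hierBP base k M) Corr (relSet RelBase k Corr)) ∧
    (∀ (Z : Set (ControlZone (gridNet 1))) (RelCZP : Set (Node 1) → Set (Node 1)),
      (∀ (C : Type) (Corr₀ : Set (Node 1)),
        IsReliable (gridNet 1) (czp Z C) Corr₀ (RelCZP Corr₀)) →
      ∀ (k : ℕ) (M : Type) (Corr : Set (Node (k + 1))),
        IsReliable (gridNet (k + 1)) (hierBP (czp Z) k M) Corr (relSet RelCZP k Corr)) := by
  exact ⟨isReliable_hierBP, fun Z => isReliable_hierBP (czp Z)⟩
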